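/- Let $(X,\|\cdot\|)$ be a real Banach space, let $\Psi:X\to[0,\infty]$ and $\Phi:X\to\mathbb{R}$, and for $\lambda>0$ set $I_\lambda=\lambda\Psi-\Phi:X\to(-\infty,\infty]$. Assume: - $(\Psi_1)$ $\Psi$ is lower semicontinuous and convex, and $\Psi(0)=0$; - $(\Psi_2)$ $\Psi(u)\to\infty$ as $\|u\|\to\infty$; - $(\Phi_1)$ $\Phi\in C^1(X,\mathbb{R})$. Let $\mathbb{D}^k$ be the closed unit ball of $\mathbb{R}^k$ centred at the origin. Consider the following conditions. - (MP) There are $\rho_0,\alpha_0>0$, $\overline\varepsilon\in(0,1)$ and $u_0\in X$ such that $\inf_{\|u\|=\rho_0}I_{1-\overline\varepsilon}(u)=\alpha_0$, $\|u_0\|>\rho_0$ and $\max\{I_{1+\overline\varepsilon}(0),I_{1+\overline\varepsilon}(u_0)\}\le 0$. In this case put, for $\lambda\in[1-\overline\varepsilon,1+\overline\varepsilon]$, $$c_0(\lambda)=\inf_{\gamma\in\Gamma_0}\sup_{t\in[0,1]}I_\lambda(\gamma(t)),\qquad \Gamma_0=\{\gamma\in C([0,1],X):\gamma(0)=0,\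 \gamma(1)=u_0\}.$$ - (E) $\Psi(-u)=\Psi(u)$ and $\Phi(-u)=\Phi(u)$ for all $u\in X$. - (SMP) There are $\rho_0,\alpha_0>0$, $\overline\varepsilon\in(0,1)$ and, for each integer $k\ge1$, an odd map $\pi_{0,k}\in C(\partial\mathbb{D}^k,X)$ such that $\inf_{\|u\|=\rho_0}I_{1-\overline\varepsilon}(u)=\alpha_0$ and, for every $k\ge 1$, $\min_{\partial\mathbb{D}^k}\|\pi_{0,k}\|>\rho_0$ and $\sup_{\partial\mathbb{D}^k}I_{1+\overline\varepsilon}\circ\pi_{0,k}<0$. In this case put, for $k\ge1$ and $\lambda\in[1-\overline\varepsilon,1+\overline\varepsilon]$, $$c_k(\lambda)=\inf_{\gamma\in\Gamma_k}\sup_{\zeta\in\mathbb{D}^k}I_\lambda(\gamma(\zeta)),\qquad \Gamma_k=\{\gamma\in C(\mathbb{D}^k,X):\gamma\text{ odd},\ \gamma=\pi_{0,k}\text{ on }\partial\mathbb{D}^k\}.$$ Suppose that either (MP) holds and $k=0$, or (E) and (SMP) hold and $k\ge1$ is an integer. Let $\lambda\in(1-\overline\varepsilon,1+\overline\varepsilon)$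 be a point at which the function $c_k$ is differentiable. Then $c_k(\lambda)$ is a real number and there is a bounded Palais–Smale sequence for $I_\lambda$ at level $c_k(\lambda)$, that is, a bounded sequence $(u_j)$ in $X$ with $I_\lambda(u_j)\to c_k(\lambda)$ for which there are $\varepsilon_j>0$, $\varepsilon_j\to0$, such that $$\lambda\,(\Psi(v)-\Psi(u_j))-\Phi'(u_j)(v-u_j)\ \ge\ -\varepsilon_j\|v-u_j\|\qquad\text{for all }j\text{ and all }v\in X.$$ (In particular $\Psi(u_j)<\infty$ for all $j$.) -/

import Mathlib

open Set Filter Topology Metric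
open scoped ENNReal NNReal

noncomputable section

namespace NonsmoothMinimax

variable {X : Type*} [NormedAddCommGroup X] [NormedSpace ℝ X]

/-- `(Ψ₁)`: `Ψ : X → [0, ∞]` is lower semicontinuous and convex, and `Ψ 0 = 0`.
Convexity is expressed with nonnegative coefficients `a + b = 1`, so that it makes sense
for values in `[0, ∞]`. -/
structure Psi1 (Ψ : X → ℝ≥0∞) : Prop where
  lsc : LowerSemicontinuous Ψ
  convex : ConvexOn ℝ≥0 Set.univ Ψ
  zero : Ψ 0 = 0

/-- `(Ψ₂)`: `Ψ u → ∞` as `‖u‖ → ∞`. -/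
def Psi2 (Ψ : X → ℝ≥0∞) : Prop :=
  Tendsto Ψ (comap (fun u : X => ‖u‖) atTop) (𝓝 ∞)

/-- `(Φ₁)`: `Φ` is of class `C¹` on `X`. -/
def Phi1 (Φ : X → ℝ) : Prop :=
  ContDiff ℝ 1 Φ

/-- `(E)`: `Ψ` and `Φ` are even. -/
def EvenPair (Ψ : X → ℝ≥0∞) (Φ : X → ℝ) : Prop :=
  ∀ u : X, Ψ (-u) = Ψ u ∧ Φ (-u) = Φ u

/-- The functional `I_lam = lam Ψ - Φ`, with values in `(-∞, ∞]`; it is only used for `0 < lam`,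
so that `lam * ∞ = ∞`. -/
def I (Ψ : X → ℝ≥0∞) (Φ : X → ℝ) (lam : ℝ) (u : X) : EReal :=
  (lam : EReal) * (Ψ u : EReal) - (Φ u : EReal)

/-- `u` is a Palais–Smale sequence for `I_lam` at level `c`.
Taking `v = 0` in the inequality shows that it forces `Ψ (u j) < ∞` for all `j`. -/
def IsPalaisSmale (Ψ : X → ℝ≥0∞) (Φ : X → ℝ) (lam : ℝ) (c : ℝ) (u : ℕ → X) : Prop :=
  Tendsto (fun j => I Ψ Φ lam (u j)) atTop (𝓝 (c : EReal)) ∧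
  ∃ ε : ℕ → ℝ, (∀ j, 0 < ε j) ∧ Tendsto ε atTop (𝓝 0) ∧
    ∀ (j : ℕ) (v : X),
      ((-(ε j * ‖v - u j‖) : ℝ) : EReal) ≤
        (lam : EReal) * ((Ψ v : EReal) - (Ψ (u j) : EReal))
          - ((fderiv ℝ Φ (u j) (v - u j) : ℝ) : EReal)

/-- `(MP)`: uniform mountain pass geometry with data `ρ₀, α₀, ε, u₀`. The bound `ε < 1` expresses
that the functionals are considered for positive parameters only. -/
structure MP (Ψ : X → ℝ≥0∞) (Φ : X → ℝ) (ρ₀ α₀ ε : ℝ) (u₀ : X) : Prop where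
  rho_pos : 0 < ρ₀
  alpha_pos : 0 < α₀
  eps_pos : 0 < ε
  eps_lt_one : ε < 1
  inf_eq : ⨅ u ∈ sphere (0 : X) ρ₀, I Ψ Φ (1 - ε) u = (α₀ : EReal)
  norm_gt : ρ₀ < ‖u₀‖
  end_le : max (I Ψ Φ (1 + ε) 0) (I Ψ Φ (1 + ε) u₀) ≤ 0

/-- The class `Γ₀` of continuous paths from `0` to `u₀`
(only the values on `[0, 1]` matter). -/
def Gamma0 (u₀ : X) : Set (ℝ → X) :=
  {γ | ContinuousOn γ (Icc 0 1) ∧ γ 0 = 0 ∧ γ 1 = u₀}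

/-- The mountain pass value `c₀(lam)`. -/
def c0 (Ψ : X → ℝ≥0∞) (Φ : X → ℝ) (u₀ : X) (lam : ℝ) : EReal :=
  ⨅ γ ∈ Gamma0 u₀, ⨆ t ∈ Icc (0 : ℝ) 1, I Ψ Φ lam (γ t)

/-- The closed unit disk of `ℝᵏ`. -/
abbrev disk (k : ℕ) : Set (EuclideanSpace ℝ (Fin k)) := closedBall 0 1

/-- The boundary of the closed unit disk of `ℝᵏ`, for `1 ≤ k`. -/
abbrev bdisk (k : ℕ) : Set (EuclideanSpace ℝ (Fin k)) := sphere 0 1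

/-- `(SMP)`: uniform symmetric mountain pass geometry with data `ρ₀, α₀, ε` and odd continuous maps
`π k : ∂𝔻ᵏ → X`, one for every `k ≥ 1` (only the values on the unit sphere matter). -/
structure SMP (Ψ : X → ℝ≥0∞) (Φ : X → ℝ) (ρ₀ α₀ ε : ℝ)
    (π : (k : ℕ) → EuclideanSpace ℝ (Fin k) → X) : Prop where
  rho_pos : 0 < ρ₀
  alpha_pos : 0 < α₀
  eps_pos : 0 < ε
  eps_lt_one : ε < 1
  inf_eq : ⨅ u ∈ sphere (0 : X) ρ₀, I Ψ Φ (1 - ε) u = (α₀ : EReal)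
  cont : ∀ k, 1 ≤ k → ContinuousOn (π k) (bdisk k)
  odd : ∀ k, 1 ≤ k → ∀ ζ ∈ bdisk k, π k (-ζ) = -π k ζ
  norm_gt : ∀ k, 1 ≤ k → ∀ ζ ∈ bdisk k, ρ₀ < ‖π k ζ‖
  sup_lt : ∀ k, 1 ≤ k → ⨆ ζ ∈ bdisk k, I Ψ Φ (1 + ε) (π k ζ) < 0

/-- The class `Γ_k` of odd continuous maps `𝔻ᵏ → X` which agree with the given map `p` on `∂𝔻ᵏ`
(only the values on the disk matter). -/
def Gamma (k : ℕ) (p : EuclideanSpace ℝ (Fin k) → X) : Set (EuclideanSpace ℝ (Fin k) → X) :=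
  {γ | ContinuousOn γ (disk k) ∧ (∀ ζ ∈ disk k, γ (-ζ) = -γ ζ) ∧ ∀ ζ ∈ bdisk k, γ ζ = p ζ}

/-- The symmetric minimax value `c_k(lam)`, for `1 ≤ k`. -/
def c (Ψ : X → ℝ≥0∞) (Φ : X → ℝ) (k : ℕ) (p : EuclideanSpace ℝ (Fin k) → X) (lam : ℝ) : EReal :=
  ⨅ γ ∈ Gamma k p, ⨆ ζ ∈ disk k, I Ψ Φ lam (γ ζ)

end NonsmoothMinimax

end

/-!
The proof is Struwe's monotonicity trick for functionals `I_μ = μ Ψ - Φ` with `Ψ` convex and lower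
semicontinuous. If the minimax value `c(μ)` is differentiable at `lam`, then a map which is optimal
for `I_{lam + h}` up to `h` stays, for `I_lam`, below the level `c(lam) + O(h)`, and at its points
with `I_lam > c(lam) - h` the difference quotient `Ψ = (I_{lam + h} - I_lam) / h` is bounded
independently of `h`. By coercivity these high points lie in a fixed ball. If there were no bounded
Palais–Smale sequence at level `c(lam)`, the Palais–Smale inequality with some constant `δ` would
fail in a slightly larger ball near that level, and pushing the high points down by the small
amount `O(h)` would contradict the definition of `c(lam)`.

The functional is not continuous along a map `γ`, so the descent directions are chosen
by a condition on the linearisation `v ↦ lam Ψ v - Φ w - Φ'(w)(v - w)`, compared with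
`max (I_lam w) b` for a threshold `b < c(lam)` (`descentSet`). This condition is convex in `v` and
open in `w`; points below `b` satisfy it with `v = w`, the others by failure of the Palais–Smale
inequality. A partition of unity gives a continuous, and after averaging equivariant, choice of `v`
near the closure of the high set, and a short step towards it lowers `I_lam` at a definite rate
(`exists_descent_step`). Instead of solving a differential equation, Ekeland's principle is applied
to the maximum of `I_lam` on the complete space of maps obtained from the initial one by moves which
either descend with slope `δ / 2` or end below `b`; the former are short, so the high points never
leave the ball (`exists_family_lt`).

Boundary values have to be kept, although points close to the boundary may be high. The initial map
is therefore first reparametrised so as to take boundary values on a collar; collar points stay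
below `b` under all admissible moves, so the high set remains away from the boundary
(`exists_bounded_palaisSmale`). Mountain pass paths and odd maps on disks are the cases of trivial
and of antipodal symmetry.
-/

namespace NonsmoothMinimax

/-! ### Ekeland's variational principle -/

/-- Ekeland's variational principle in its weak form: some point is a strict minimum of `f` up to a
perturbation of slope `κ`. -/
theorem exists_forall_lt_add_mul_dist {M : Type*} [MetricSpace M] [CompleteSpace M] [Nonempty M]
    {f : M → ℝ} (hf : LowerSemicontinuous f) (hbdd : BddBelow (range f)) {κ : ℝ} (hκ : 0 < κ) :
    ∃ x, ∀ y, y ≠ x → f x < f y + κ * dist x y := by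
  obtain ⟨a, ha⟩ := hbdd
  have ha : ∀ x, a ≤ f x := fun x => ha (mem_range_self x)
  -- `S x` is the set of points below `x` in the order defined by `f` and `κ`.
  let S : M → Set M := fun x => {y | f y + κ * dist x y ≤ f x}
  have hself : ∀ x, x ∈ S x := fun x => by simp [S]
  have htrans : ∀ x y z, y ∈ S x → z ∈ S y → z ∈ S x := by
    intro x y z hy hz
    simp only [S, mem_ofPred_eq] at *
    nlinarith [dist_triangle x y z]
  have hclosed : ∀ x, IsClosed (S x) := by
    intro x
    have h : LowerSemicontinuous fun y => f y + κ * dist x y :=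
      hf.add (Continuous.lowerSemicontinuous (by fun_prop))
    exact h.isClosed_preimage (f x)
  have hbd : ∀ x, BddBelow (f '' S x) := fun x => ⟨a, by rintro _ ⟨y, -, rfl⟩; exact ha y⟩
  have hstep : ∀ (n : ℕ) x, ∃ y ∈ S x, f y < sInf (f '' S x) + (1 / 2) ^ n := by
    intro n x
    obtain ⟨_, ⟨y, hy, rfl⟩, hlt⟩ := exists_lt_of_csInf_lt (s := f '' S x)
      ⟨_, mem_image_of_mem f (hself x)⟩
      (lt_add_of_pos_right (sInf (f '' S x)) (by positivity : (0 : ℝ) < (1 / 2) ^ n))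
    exact ⟨y, hy, hlt⟩
  choose g hgS hglt using hstep
  obtain ⟨x₀⟩ := ‹Nonempty M›
  let x : ℕ → M := fun n => Nat.rec x₀ (fun n y => g n y) n
  have hx : ∀ n, x (n + 1) = g n (x n) := fun n => rfl
  have hmono : ∀ n k, x (n + k) ∈ S (x n) := by
    intro n k
    induction k with
    | zero => exact hself _
    | succ k ih => exact htrans _ _ _ ih (by rw [← add_assoc, hx]; exact hgS _ _)
  -- Every point below `x (n + 1)` is within `2⁻ⁿ / κ` of `x (n + 1)`.
  have hsmall : ∀ n, ∀ y ∈ S (x (n + 1)), κ * dist (x (n + 1)) y ≤ (1 / 2) ^ n := by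
    intro n y hy
    have h1 : y ∈ S (x n) := htrans _ _ _ (hmono n 1) hy
    have h2 : sInf (f '' S (x n)) ≤ f y := csInf_le (hbd _) (mem_image_of_mem f h1)
    have h3 := hglt n (x n)
    rw [← hx] at h3
    simp only [S, mem_ofPred_eq] at hy
    linarith
  have hcauchy : CauchySeq fun n => x (n + 1) := by
    refine cauchySeq_of_le_tendsto_0 (fun n => (1 / 2) ^ n / κ * 2) ?_ ?_
    · intro n m N hn hm
      have h := fun m (hm : N ≤ m) => hsmall N (x (m + 1)) (by
        obtain ⟨k, rfl⟩ := Nat.exists_eq_add_of_le hm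
        have := hmono (N + 1) k
        rwa [show N + 1 + k = N + k + 1 by ring] at this)
      have h1 : ∀ m, N ≤ m → dist (x (N + 1)) (x (m + 1)) ≤ (1 / 2) ^ N / κ := fun m hm => by
        rw [le_div_iff₀ hκ]; linarith [h m hm]
      linarith [h1 n hn, h1 m hm, dist_triangle_left (x (n + 1)) (x (m + 1)) (x (N + 1))]
    · have := (tendsto_pow_atTop_nhds_zero_of_lt_one (r := (1 / 2 : ℝ)) (by norm_num)
        (by norm_num)).div_const κ |>.mul_const 2
      simpa using this
  obtain ⟨z, hz⟩ := cauchySeq_tendsto_of_complete hcauchy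
  have hzS : ∀ n, z ∈ S (x (n + 1)) := by
    intro n
    refine (hclosed _).mem_of_tendsto hz (eventually_atTop.2 ⟨n, fun m hm => ?_⟩)
    obtain ⟨k, rfl⟩ := Nat.exists_eq_add_of_le hm
    have := hmono (n + 1) k
    rwa [show n + 1 + k = n + k + 1 by ring] at this
  refine ⟨z, fun y hy => ?_⟩
  by_contra! hcon
  have hyS : y ∈ S z := hcon
  refine hy (tendsto_nhds_unique (f := fun n => x (n + 1)) (tendsto_iff_dist_tendsto_zero.2 ?_) hz)
  have h0 := (tendsto_pow_atTop_nhds_zero_of_lt_one (r := (1 / 2 : ℝ)) (by norm_num)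
    (by norm_num)).div_const κ
  rw [zero_div] at h0
  refine squeeze_zero (fun _ => dist_nonneg) (fun n => ?_) h0
  rw [le_div_iff₀ hκ]
  linarith [hsmall n y (htrans _ _ _ (hzS n) hyS)]

section Deformation

variable {X : Type*} [NormedAddCommGroup X] [NormedSpace ℝ X]

/-! ### Descent directions -/

/-- Pairs `(v, m)` such that moving from `w` towards `v` lowers the linearisation
`F v - Φ w - Φ'(w)(v - w)` of `F - Φ` below `max (F w - Φ w) b` at the rate `δ` per unit of the
number `m > ‖v - w‖`. Recording `m` separately keeps the set convex and provides a positive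
normalising factor even where `v = w`. -/
def descentSet (Ω : Set X) (F Φ : X → ℝ) (δ b : ℝ) (w : X) : Set (X × ℝ) :=
  {p | p.1 ∈ Ω ∧ ‖p.1 - w‖ < p.2 ∧
    F p.1 - Φ w - fderiv ℝ Φ w (p.1 - w) + δ * p.2 < max (F w - Φ w) b}

variable {Ω : Set X} {F Φ : X → ℝ} {δ b : ℝ}

theorem convex_descentSet (hF : ConvexOn ℝ Ω F) (w : X) :
    Convex ℝ (descentSet Ω F Φ δ b w) := by
  rintro ⟨v₁, m₁⟩ ⟨h1, h2, h3⟩ ⟨v₂, m₂⟩ ⟨k1, k2, k3⟩ a c ha hc hac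
  simp only at *
  have hv : a • v₁ + c • v₂ - w = a • (v₁ - w) + c • (v₂ - w) := by
    rw [smul_sub, smul_sub, sub_add_sub_comm, ← add_smul a c, hac, one_smul]
  -- Strict inequalities survive convex combinations, also when a weight vanishes.
  have hcomb : ∀ {p q r s : ℝ}, p < q → r < s → a * p + c * r < a * q + c * s := by
    intro p q r s hpq hrs
    rcases ha.eq_or_lt with rfl | ha'
    · have : c = 1 := by linarith
      subst this; linarith
    · nlinarith [mul_lt_mul_of_pos_left hpq ha', mul_le_mul_of_nonneg_left hrs.le hc]
  refine ⟨hF.1 h1 k1 ha hc hac, ?_, ?_⟩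
  · simp only [Prod.fst_add, Prod.smul_fst, Prod.snd_add, Prod.smul_snd, smul_eq_mul]
    rw [hv]
    calc _ ≤ ‖a • (v₁ - w)‖ + ‖c • (v₂ - w)‖ := norm_add_le _ _
      _ = a * ‖v₁ - w‖ + c * ‖v₂ - w‖ := by
        rw [norm_smul, norm_smul, Real.norm_of_nonneg ha, Real.norm_of_nonneg hc]
      _ < _ := hcomb h2 k2
  · simp only [Prod.fst_add, Prod.smul_fst, Prod.snd_add, Prod.smul_snd, smul_eq_mul]
    rw [hv, map_add, map_smul, map_smul, smul_eq_mul, smul_eq_mul]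
    have hFc := hF.2 h1 k1 ha hc hac
    simp only [smul_eq_mul] at hFc
    have hlt := hcomb h3 k3
    have e1 : a * Φ w + c * Φ w = Φ w := by rw [← add_mul, hac, one_mul]
    have e2 : a * max (F w - Φ w) b + c * max (F w - Φ w) b = max (F w - Φ w) b := by
      rw [← add_mul, hac, one_mul]
    rw [e2] at hlt
    nlinarith

/-- The descent condition is stable under small perturbations of the base point: the linearisation
is continuous in the base point `w`, since it does not involve `F w`, while `F - Φ` is lower
semicontinuous. -/
theorem eventually_mem_descentSet (hcl : IsClosed {p : X × ℝ | p.1 ∈ Ω ∧ F p.1 ≤ p.2})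
    (hΦ : ContDiff ℝ 1 Φ) {w : X} {p : X × ℝ} (hp : p ∈ descentSet Ω F Φ δ b w) :
    ∀ᶠ y in 𝓝[Ω] w, p ∈ descentSet Ω F Φ δ b y := by
  obtain ⟨h1, h2, h3⟩ := hp
  have hΦc : Continuous Φ := hΦ.continuous
  have hΦ' : Continuous (fderiv ℝ Φ) := hΦ.continuous_fderiv one_ne_zero
  have hℓ : Continuous fun y => F p.1 - Φ y - fderiv ℝ Φ y (p.1 - y) + δ * p.2 :=
    ((continuous_const.sub hΦc).sub (hΦ'.clm_apply (continuous_const.sub continuous_id))).add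
      continuous_const
  have hnorm : ∀ᶠ y in 𝓝[Ω] w, ‖p.1 - y‖ < p.2 :=
    nhdsWithin_le_nhds ((by fun_prop : Continuous fun y => ‖p.1 - y‖).continuousAt.eventually_lt
      continuousAt_const h2)
  rcases lt_max_iff.1 h3 with h | h
  · have hmem : w ∉ {y | y ∈ Ω ∧
        F y ≤ (F p.1 - Φ y - fderiv ℝ Φ y (p.1 - y) + δ * p.2) + Φ y} := by
      rintro ⟨-, h'⟩; linarith
    have hc : IsClosed {y | y ∈ Ω ∧
        F y ≤ (F p.1 - Φ y - fderiv ℝ Φ y (p.1 - y) + δ * p.2) + Φ y} :=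
      hcl.preimage (continuous_id.prodMk (hℓ.add hΦc))
    filter_upwards [hnorm, nhdsWithin_le_nhds (hc.isOpen_compl.mem_nhds hmem),
      self_mem_nhdsWithin] with y hy1 hy2 hy3
    refine ⟨h1, hy1, lt_max_of_lt_left ?_⟩
    by_contra! hcon
    exact hy2 ⟨hy3, by linarith⟩
  · filter_upwards [hnorm, nhdsWithin_le_nhds
      (hℓ.continuousAt.eventually_lt continuousAt_const h)] with y hy1 hy2
    exact ⟨h1, hy1, lt_max_of_lt_right hy2⟩

/-- A point at which `F - Φ` is below the threshold `b` is its own descent direction. -/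
theorem descentSet_nonempty_of_lt (hδ : 0 < δ) {w : X} (hw : w ∈ Ω) (h : F w - Φ w < b) :
    (descentSet Ω F Φ δ b w).Nonempty := by
  refine ⟨(w, (b - (F w - Φ w)) / (2 * δ)), hw, ?_, ?_⟩
  · simp only [sub_self, norm_zero]
    exact div_pos (by linarith) (by linarith)
  · simp only [sub_self, map_zero, sub_zero]
    have : δ * ((b - (F w - Φ w)) / (2 * δ)) = (b - (F w - Φ w)) / 2 := by field_simp
    rw [this]
    exact lt_max_of_lt_right (by linarith)

/-- A point at which the Palais–Smale inequality with constant `δ` fails has a descent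
direction. -/
theorem descentSet_nonempty_of_exists (hδ : 0 < δ) {w : X}
    (h : ∃ v ∈ Ω, F v - F w - fderiv ℝ Φ w (v - w) < -(δ * ‖v - w‖)) :
    (descentSet Ω F Φ δ b w).Nonempty := by
  obtain ⟨v, hv, h⟩ := h
  -- The gap in the strict inequality is shared between the margin `δ * q` and its remainder.
  set q := (-(δ * ‖v - w‖) - (F v - F w - fderiv ℝ Φ w (v - w))) / (2 * δ) with hq
  have hq0 : 0 < q := div_pos (by linarith) (by linarith)
  have hδq : δ * q = (-(δ * ‖v - w‖) - (F v - F w - fderiv ℝ Φ w (v - w))) / 2 := by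
    rw [hq]; field_simp
  refine ⟨(v, ‖v - w‖ + q), hv, by simpa using hq0, lt_max_of_lt_left ?_⟩
  simp only
  rw [mul_add, hδq]
  linarith

theorem map_mem_descentSet {e : X ≃ₗᵢ[ℝ] X} (hΩe : ∀ x ∈ Ω, e x ∈ Ω)
    (hFe : ∀ x, F (e x) = F x) (hΦe : ∀ x, Φ (e x) = Φ x) (hΦ : Differentiable ℝ Φ) {w : X}
    {p : X × ℝ} (hp : p ∈ descentSet Ω F Φ δ b w) :
    (e p.1, p.2) ∈ descentSet Ω F Φ δ b (e w) := by
  obtain ⟨h1, h2, h3⟩ := hp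
  have hfd : fderiv ℝ Φ w = (fderiv ℝ Φ (e w)).comp (e : X →L[ℝ] X) := by
    have h := ((hΦ (e w)).hasFDerivAt.comp w (e : X →L[ℝ] X).hasFDerivAt)
    have heq : Φ ∘ e = Φ := funext hΦe
    change HasFDerivAt (Φ ∘ e) _ w at h
    rw [heq] at h
    exact h.fderiv
  refine ⟨hΩe _ h1, ?_, ?_⟩
  · simp only [← map_sub, e.norm_map]; exact h2
  · rw [hfd] at h3
    simp only [hFe, hΦe, ← map_sub]
    exact h3

/-- A `C¹` function is uniformly differentiable near a compact set. -/
theorem exists_uniform_remainder {K : Set X} (hK : IsCompact K) (hΦ : ContDiff ℝ 1 Φ) {κ : ℝ}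
    (hκ : 0 < κ) :
    ∃ r > 0, ∀ w ∈ K, ∀ y, ‖y - w‖ < r →
      |Φ y - Φ w - fderiv ℝ Φ w (y - w)| ≤ κ * ‖y - w‖ := by
  have hΦ' : Continuous (fderiv ℝ Φ) := hΦ.continuous_fderiv one_ne_zero
  have h := hK.uniformContinuousAt_of_continuousAt (fderiv ℝ Φ)
    (fun a _ => hΦ'.continuousAt) (Metric.dist_mem_uniformity hκ)
  obtain ⟨r, hr, hsub⟩ := Metric.mem_uniformity_dist.1 h
  refine ⟨r, hr, fun w hw y hy => ?_⟩
  have hdiff : Differentiable ℝ Φ := hΦ.differentiable one_ne_zero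
  refine (convex_ball w r).norm_image_sub_le_of_norm_hasFDerivWithin_le'
    (f' := fderiv ℝ Φ) (fun x _ => (hdiff x).hasFDerivAt.hasFDerivWithinAt) (fun x hx => ?_)
    (mem_ball_self hr) (by rwa [mem_ball, dist_eq_norm])
  have : (fderiv ℝ Φ w, fderiv ℝ Φ x) ∈ {p : (X →L[ℝ] ℝ) × (X →L[ℝ] ℝ) | dist p.1 p.2 < κ} :=
    hsub (a := w) (b := x) (by rw [dist_comm]; exact hx) hw
  rw [← dist_eq_norm, dist_comm]
  exact le_of_lt this

/-! ### Deformation of a compact family -/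

/-- One step of the deformation: if descent directions exist on the closure of the part of the
family `γ` lying above the threshold `b`, then `γ` can be moved by at most `s`, fixing `B` and
preserving the symmetry, so that this part drops by `δ / 2 * s` and the rest stays
below `b`. -/
theorem exists_descent_step {D : Type*} [TopologicalSpace D] [CompactSpace D] [T2Space D]
    (hF : ConvexOn ℝ Ω F) (hcl : IsClosed {p : X × ℝ | p.1 ∈ Ω ∧ F p.1 ≤ p.2})
    (hΦ : ContDiff ℝ 1 Φ) {e : X ≃ₗᵢ[ℝ] X} (hee : ∀ x, e (e x) = x)
    (hΩe : ∀ x ∈ Ω, e x ∈ Ω) (hFe : ∀ x, F (e x) = F x) (hΦe : ∀ x, Φ (e x) = Φ x)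
    {σ : C(D, D)} (hσ : ∀ t, σ (σ t) = t) {γ : C(D, X)} (hγ : ∀ t, γ (σ t) = e (γ t))
    (hγΩ : ∀ t, γ t ∈ Ω) {B : Set D} (hB : IsClosed B) (hBσ : ∀ t ∈ B, σ t ∈ B) (hδ : 0 < δ)
    (hdisj : Disjoint (closure {t | b < F (γ t) - Φ (γ t)}) B)
    (hne : ∀ t ∈ closure {t | b < F (γ t) - Φ (γ t)}, (descentSet Ω F Φ δ b (γ t)).Nonempty)
    {s₁ : ℝ} (hs₁ : 0 < s₁) :
    ∃ s, 0 < s ∧ s ≤ s₁ ∧ ∃ γ' : C(D, X), (∀ t, γ' (σ t) = e (γ' t)) ∧ (∀ t, γ' t ∈ Ω) ∧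
      (∀ t ∈ B, γ' t = γ t) ∧ (∀ t, ‖γ' t - γ t‖ ≤ s) ∧
      (∀ t, F (γ t) - Φ (γ t) ≤ b → F (γ' t) - Φ (γ' t) ≤ b) ∧
      ∀ t, b < F (γ t) - Φ (γ t) →
        F (γ' t) - Φ (γ' t) ≤ F (γ t) - Φ (γ t) - δ / 2 * s := by
  set C := closure {t | b < F (γ t) - Φ (γ t)}
  have hCσ : ∀ t ∈ C, σ t ∈ C := fun t ht =>
    map_mem_closure σ.continuous ht fun t' ht' => by
      simpa only [mem_ofPred_eq, hγ, hFe, hΦe] using ht'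
  have hev : ∀ t p, p ∈ descentSet Ω F Φ δ b (γ t) →
      ∀ᶠ t' in 𝓝 t, p ∈ descentSet Ω F Φ δ b (γ t') := fun t p hp =>
    (tendsto_nhdsWithin_iff.2 ⟨γ.continuous.continuousAt, Eventually.of_forall hγΩ⟩).eventually
      (eventually_mem_descentSet hcl hΦ hp)
  have hdσ : ∀ t p, p ∈ descentSet Ω F Φ δ b (γ t) →
      (e p.1, p.2) ∈ descentSet Ω F Φ δ b (γ (σ t)) := fun t p hp => by
    rw [hγ]; exact map_mem_descentSet hΩe hFe hΦe (hΦ.differentiable one_ne_zero) hp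
  set U : Set D := {t | (descentSet Ω F Φ δ b (γ t)).Nonempty}
  have hU : IsOpen U := isOpen_iff_mem_nhds.2 fun t ⟨p, hp⟩ =>
    (hev t p hp).mono fun t' ht' => ⟨p, ht'⟩
  have hUσ : ∀ t, σ t ∈ U → t ∈ U := by
    rintro t ⟨p, hp⟩
    have := hdσ _ _ hp
    rw [hσ] at this
    exact ⟨_, this⟩
  obtain ⟨W, hW, hCW, hWU⟩ := normal_exists_closure_subset (isClosed_closure (s :=
    {t | b < F (γ t) - Φ (γ t)})) (hU.inter hB.isOpen_compl)
    (fun t ht => ⟨hne t ht, fun htB => hdisj.le_bot ⟨ht, htB⟩⟩)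
  set Z : Set D := closure W ∪ σ ⁻¹' closure W
  have hZ : IsClosed Z := isClosed_closure.union (isClosed_closure.preimage σ.continuous)
  have hZσ : ∀ t, t ∈ Z → σ t ∈ Z := by
    rintro t (ht | ht)
    · exact Or.inr (by rwa [mem_preimage, hσ])
    · exact Or.inl ht
  have hZU : Z ⊆ U := by
    rintro t (ht | ht)
    · exact (hWU ht).1
    · exact hUσ t (hWU ht).1
  -- Outside the closed neighbourhood `Z` of `C` nothing moves, so that only positivity of the
  -- normalising factor is asked for there; this lets a locally constant choice exist everywhere.
  let T : D → Set (X × ℝ) := fun t => {p | 0 < p.2 ∧ (t ∈ Z → p ∈ descentSet Ω F Φ δ b (γ t))}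
  have hT : ∀ t, Convex ℝ (T t) := by
    intro t
    have h1 : Convex ℝ {p : X × ℝ | 0 < p.2} :=
      convex_halfSpace_gt (f := fun p : X × ℝ => p.2) ⟨fun _ _ => rfl, fun _ _ => rfl⟩ 0
    by_cases ht : t ∈ Z
    · have := h1.inter (convex_descentSet (Φ := Φ) (δ := δ) (b := b) hF (γ t))
      convert this using 1
      ext p; simp [T, ht]
    · convert h1 using 1
      ext p; simp [T, ht]
  obtain ⟨g, hg⟩ := exists_continuous_forall_mem_convex_of_local_const hT (by
    intro t
    by_cases ht : t ∈ U
    · obtain ⟨p, hp⟩ := ht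
      exact ⟨p, (hev t p hp).mono fun t' ht' => ⟨(norm_nonneg _).trans_lt hp.2.1, fun _ => ht'⟩⟩
    · refine ⟨(0, 1), ?_⟩
      filter_upwards [hZ.isOpen_compl.mem_nhds fun h => ht (hZU h)] with t' ht'
      exact ⟨one_pos, fun h => absurd h ht'⟩)
  -- Averaging over the symmetry makes the selection equivariant.
  let q : D → X × ℝ := fun t => (1 / 2 : ℝ) • g t + (1 / 2 : ℝ) • (e (g (σ t)).1, (g (σ t)).2)
  have hqc : Continuous q := by fun_prop
  have hqT : ∀ t, q t ∈ T t := by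
    intro t
    have h : (e (g (σ t)).1, (g (σ t)).2) ∈ T t := ⟨(hg (σ t)).1, fun ht => by
      have := hdσ _ _ ((hg (σ t)).2 (hZσ t ht))
      rwa [hσ] at this⟩
    exact hT t (hg t) h (by norm_num) (by norm_num) (by norm_num)
  have hqσ : ∀ t, q (σ t) = (e (q t).1, (q t).2) := by
    intro t
    ext
    · simp only [q, hσ, Prod.fst_add, Prod.smul_fst, map_add, map_smul, hee]
      exact add_comm _ _
    · simp only [q, hσ, Prod.snd_add, Prod.smul_snd]
      exact add_comm _ _
  obtain ⟨χ₀, hχ₀0, hχ₀1, hχ₀⟩ := exists_continuous_zero_one_of_isClosed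
    (hW.isClosed_compl.union hB) (isClosed_closure (s := {t | b < F (γ t) - Φ (γ t)})) (by
      rw [Set.disjoint_union_left]
      exact ⟨Set.disjoint_left.2 fun t ht ht' => ht (hCW ht'), hdisj.symm⟩)
  -- The cutoff equals `1` on `C` and vanishes on `B` and off `Z`.
  let χ : D → ℝ := fun t => (χ₀ t + χ₀ (σ t)) / 2
  have hχc : Continuous χ := by fun_prop
  have hχσ : ∀ t, χ (σ t) = χ t := fun t => by simp only [χ, hσ, add_comm]
  have hχ0 : ∀ t, 0 ≤ χ t := fun t => by
    have := (hχ₀ t).1; have := (hχ₀ (σ t)).1; simp only [χ]; linarith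
  have hχ1 : ∀ t, χ t ≤ 1 := fun t => by
    have := (hχ₀ t).2; have := (hχ₀ (σ t)).2; simp only [χ]; linarith
  have hχC : ∀ t ∈ C, χ t = 1 := fun t ht => by
    simp [χ, hχ₀1 ht, hχ₀1 (hCσ t ht)]
  have hχB : ∀ t ∈ B, χ t = 0 := fun t ht => by
    simp [χ, hχ₀0 (Or.inr ht), hχ₀0 (Or.inr (hBσ t ht))]
  have hχZ : ∀ t, t ∉ Z → χ t = 0 := fun t ht => by
    have h1 : t ∈ Wᶜ := fun h => ht (Or.inl (subset_closure h))
    have h2 : σ t ∈ Wᶜ := fun h => ht (Or.inr (subset_closure h))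
    simp [χ, hχ₀0 (Or.inl h1), hχ₀0 (Or.inl h2)]
  obtain ⟨m₀, hm₀, hm⟩ : ∃ m₀ > 0, ∀ t, m₀ ≤ (q t).2 := by
    rcases isEmpty_or_nonempty D with h | h
    · exact ⟨1, one_pos, fun t => h.elim t⟩
    · obtain ⟨t, -, ht⟩ := isCompact_univ.exists_isMinOn univ_nonempty
        (hqc.snd.continuousOn (s := univ))
      exact ⟨_, (hqT t).1, fun t' => ht (mem_univ t')⟩
  obtain ⟨r, hr, hrem⟩ := exists_uniform_remainder (isCompact_range γ.continuous) hΦ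
    (half_pos hδ)
  -- `s ≤ m₀` keeps the convex weight `τ` below `1`; `s < r` makes the remainder estimate available.
  set s := min s₁ (min m₀ (r / 2))
  have hs0 : 0 < s := lt_min hs₁ (lt_min hm₀ (half_pos hr))
  have hsm : s ≤ m₀ := (min_le_right _ _).trans (min_le_left _ _)
  have hsr : s < r := ((min_le_right _ _).trans (min_le_right _ _)).trans_lt (half_lt_self hr)
  let τ : D → ℝ := fun t => s * χ t / (q t).2
  have hτc : Continuous τ := by
    refine (continuous_const.mul hχc).div hqc.snd fun t => (hqT t).1.ne'
  have hτ0 : ∀ t, 0 ≤ τ t := fun t => div_nonneg (mul_nonneg hs0.le (hχ0 t)) (hqT t).1.le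
  have hτ1 : ∀ t, τ t ≤ 1 := fun t => by
    rw [div_le_one (hqT t).1]
    nlinarith [hm t, hχ0 t, hχ1 t]
  have hτm : ∀ t, τ t * (q t).2 = s * χ t := fun t => div_mul_cancel₀ _ (hqT t).1.ne'
  have hτσ : ∀ t, τ (σ t) = τ t := fun t => by simp only [τ, hχσ, hqσ]
  let γ' : C(D, X) := ⟨fun t => γ t + τ t • ((q t).1 - γ t),
    γ.continuous.add (hτc.smul (hqc.fst.sub γ.continuous))⟩
  have hγ' : ∀ t, γ' t = γ t + τ t • ((q t).1 - γ t) := fun t => rfl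
  have hτZ : ∀ t, t ∉ Z → γ' t = γ t := fun t ht => by
    simp [hγ', τ, hχZ t ht]
  have hdist : ∀ t, ‖γ' t - γ t‖ ≤ s * χ t := by
    intro t
    by_cases ht : t ∈ Z
    · rw [hγ', add_sub_cancel_left, norm_smul, Real.norm_of_nonneg (hτ0 t), ← hτm]
      exact mul_le_mul_of_nonneg_left ((hqT t).2 ht).2.1.le (hτ0 t)
    · rw [hτZ t ht, sub_self, norm_zero]
      exact mul_nonneg hs0.le (hχ0 t)
  -- Convexity of `F` bounds the energy by the linearisation, and half of the descent rate `δ`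
  -- absorbs the remainder of `Φ`.
  have hkey : ∀ t, γ' t ∈ Ω ∧
      F (γ' t) - Φ (γ' t) ≤ max (F (γ t) - Φ (γ t)) b - δ / 2 * (s * χ t) := by
    intro t
    by_cases ht : t ∈ Z
    · obtain ⟨h1, h2, h3⟩ := (hqT t).2 ht
      have heq : γ' t = (1 - τ t) • γ t + τ t • (q t).1 := by
        rw [hγ', smul_sub, sub_smul, one_smul]; abel
      have hΩ' : γ' t ∈ Ω := by
        rw [heq]; exact hF.1 (hγΩ t) h1 (by linarith [hτ1 t]) (hτ0 t) (by ring)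
      refine ⟨hΩ', ?_⟩
      have hFc : F (γ' t) ≤ (1 - τ t) * F (γ t) + τ t * F (q t).1 := by
        rw [heq]; exact hF.2 (hγΩ t) h1 (by linarith [hτ1 t]) (hτ0 t) (by ring)
      have hR := hrem (γ t) (mem_range_self t) (γ' t)
        (((hdist t).trans (mul_le_of_le_one_right hs0.le (hχ1 t))).trans_lt hsr)
      have hlin : fderiv ℝ Φ (γ t) (γ' t - γ t) =
          τ t * fderiv ℝ Φ (γ t) ((q t).1 - γ t) := by
        rw [hγ', add_sub_cancel_left, map_smul, smul_eq_mul]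
      rw [hlin] at hR
      have hR' := (abs_le.1 hR).1
      have hd := mul_le_mul_of_nonneg_left (hdist t) (half_pos hδ).le
      have h4 := mul_le_mul_of_nonneg_left h3.le (hτ0 t)
      have h5 := mul_le_mul_of_nonneg_left (le_max_left (F (γ t) - Φ (γ t)) b)
        (by linarith [hτ1 t] : 0 ≤ 1 - τ t)
      have h6 : τ t * (δ * (q t).2) = δ * (s * χ t) := by rw [← hτm]; ring
      rw [mul_add, h6] at h4
      linarith
    · rw [hτZ t ht, hχZ t ht]
      simp only [mul_zero, sub_zero]
      exact ⟨hγΩ t, le_max_left _ _⟩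
  refine ⟨s, hs0, min_le_left _ _, γ', fun t => ?_, fun t => (hkey t).1, fun t ht => ?_,
    fun t => (hdist t).trans (mul_le_of_le_one_right hs0.le (hχ1 t)), fun t ht => ?_,
    fun t ht => ?_⟩
  · rw [hγ', hγ', hτσ, hqσ, hγ, map_add, map_smul, map_sub]
  · simp [hγ', τ, hχB t ht]
  · have := (hkey t).2
    rw [max_eq_right ht] at this
    exact this.trans (sub_le_self _ (mul_nonneg (half_pos hδ).le (mul_nonneg hs0.le (hχ0 t))))
  · have := (hkey t).2
    rwa [max_eq_left ht.le, hχC t (subset_closure ht), mul_one] at this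

/-- If the Palais–Smale inequality with constant `δ` fails throughout the part of a bounded region
between the levels `b` and `C`, then a family `γ₀` below the level `C` whose part above `b` stays
away from `B` and inside the ball of radius `R` can be deformed, relative to `B`, below any level
`c > b`. Since `C - b ≤ δ / 2`, the part above `b` moves by at most `1`. -/
theorem exists_family_lt {D : Type*} [TopologicalSpace D] [CompactSpace D] [T2Space D] [Nonempty D]
    [CompleteSpace X]
    (hF : ConvexOn ℝ Ω F) (hcl : IsClosed {p : X × ℝ | p.1 ∈ Ω ∧ F p.1 ≤ p.2})
    (hΦ : ContDiff ℝ 1 Φ) {e : X ≃ₗᵢ[ℝ] X} (hee : ∀ x, e (e x) = x)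
    (hΩe : ∀ x ∈ Ω, e x ∈ Ω) (hFe : ∀ x, F (e x) = F x) (hΦe : ∀ x, Φ (e x) = Φ x)
    {σ : C(D, D)} (hσ : ∀ t, σ (σ t) = t) {γ₀ : C(D, X)} (hγ₀ : ∀ t, γ₀ (σ t) = e (γ₀ t))
    (hγ₀Ω : ∀ t, γ₀ t ∈ Ω) {B N : Set D} (hB : IsClosed B) (hBσ : ∀ t ∈ B, σ t ∈ B)
    (hN : IsOpen N) (hBN : B ⊆ N) (hδ : 0 < δ) {C R c : ℝ}
    (hNb : ∀ t ∈ N, F (γ₀ t) - Φ (γ₀ t) ≤ b) (hC : ∀ t, F (γ₀ t) - Φ (γ₀ t) ≤ C)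
    (hR : ∀ t, b < F (γ₀ t) - Φ (γ₀ t) → ‖γ₀ t‖ ≤ R) (hCb : C - b ≤ δ / 2) (hbc : b < c)
    (hPS : ∀ w ∈ Ω, ‖w‖ ≤ R + 1 → b ≤ F w - Φ w → F w - Φ w ≤ C →
      ∃ v ∈ Ω, F v - F w - fderiv ℝ Φ w (v - w) < -(δ * ‖v - w‖)) :
    ∃ γ : C(D, X), (∀ t, γ (σ t) = e (γ t)) ∧ (∀ t ∈ B, γ t = γ₀ t) ∧ (∀ t, γ t ∈ Ω) ∧
      ∃ a < c, ∀ t, F (γ t) - Φ (γ t) ≤ a := by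
  by_contra! hcon
  have hlow : ∀ γ : C(D, X), (∀ t, γ (σ t) = e (γ t)) → (∀ t ∈ B, γ t = γ₀ t) →
      (∀ t, γ t ∈ Ω) → ∀ a, (∀ t, F (γ t) - Φ (γ t) ≤ a) → c ≤ a := by
    intro γ h1 h2 h3 a ha
    by_contra! hlt
    obtain ⟨t, ht⟩ := hcon γ h1 h2 h3 a hlt
    exact absurd (ha t) (not_le.2 ht)
  have hcC : c ≤ C := hlow γ₀ hγ₀ (fun _ _ => rfl) hγ₀Ω C hC
  have hΦc : Continuous Φ := hΦ.continuous
  have hκ : 0 < δ / 2 := half_pos hδ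
  -- Families obtained from `γ₀` by moving each point either below `b` or along a descent of
  -- slope at least `δ / 2`. This relation between families is transitive.
  let S : Set C(D, X) := {γ | (∀ t, γ (σ t) = e (γ t)) ∧ (∀ t ∈ B, γ t = γ₀ t) ∧
    ∀ t, (γ t ∈ Ω ∧ F (γ t) ≤ F (γ₀ t) - Φ (γ₀ t) - δ / 2 * ‖γ t - γ₀ t‖ + Φ (γ t)) ∨
      (γ t ∈ Ω ∧ F (γ t) ≤ b + Φ (γ t))}
  have hev : ∀ t, Continuous fun γ : C(D, X) => γ t := fun t => continuous_eval_const t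
  have hsub : ∀ (t : D) (u : C(D, X) → ℝ), Continuous u →
      IsClosed {γ : C(D, X) | γ t ∈ Ω ∧ F (γ t) ≤ u γ} := fun t u hu =>
    hcl.preimage ((hev t).prodMk hu)
  have hSclosed : IsClosed S := by
    refine IsClosed.and ?_ (IsClosed.and ?_ ?_)
    · simp only [ofPred_forall]
      exact isClosed_iInter fun t => isClosed_eq (hev _) (e.continuous.comp (hev t))
    · simp only [ofPred_forall]
      exact isClosed_iInter fun t => isClosed_iInter fun _ => isClosed_eq (hev t) continuous_const
    · simp only [ofPred_forall]
      refine isClosed_iInter fun t => (hsub t _ ?_).union (hsub t _ ?_)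
      · have := hev t; fun_prop
      · have := hev t; fun_prop
  have hSΩ : ∀ γ ∈ S, ∀ t, γ t ∈ Ω := fun γ hγ t => (hγ.2.2 t).elim And.left And.left
  have hSC : ∀ γ ∈ S, ∀ t, F (γ t) - Φ (γ t) ≤ C := by
    intro γ hγ t
    rcases hγ.2.2 t with h | h
    · linarith [hC t, h.2, mul_nonneg hκ.le (norm_nonneg (γ t - γ₀ t))]
    · linarith [h.2]
  have : Nonempty S := ⟨⟨γ₀, hγ₀, fun _ _ => rfl, fun t => Or.inl ⟨hγ₀Ω t, by simp⟩⟩⟩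
  have : CompleteSpace S := hSclosed.completeSpace_coe
  let f : S → ℝ := fun γ => ⨆ t, (F (γ.1 t) - Φ (γ.1 t))
  have hbdd : ∀ γ : S, BddAbove (range fun t => F (γ.1 t) - Φ (γ.1 t)) := fun γ =>
    ⟨C, by rintro _ ⟨t, rfl⟩; exact hSC γ.1 γ.2 t⟩
  have hfle : ∀ (γ : S) a, f γ ≤ a ↔ ∀ t, F (γ.1 t) - Φ (γ.1 t) ≤ a := fun γ a =>
    ciSup_le_iff (hbdd γ)
  have hcf : ∀ γ : S, c ≤ f γ := fun γ =>
    hlow γ.1 γ.2.1 γ.2.2.1 (hSΩ _ γ.2) _ ((hfle γ _).1 le_rfl)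
  have hlsc : LowerSemicontinuous f := by
    rw [lowerSemicontinuous_iff_isClosed_preimage]
    intro a
    have : f ⁻¹' Iic a = Subtype.val ⁻¹'
        ⋂ t, {γ : C(D, X) | γ t ∈ Ω ∧ F (γ t) ≤ a + Φ (γ t)} := by
      ext γ
      simp only [mem_preimage, mem_Iic, hfle, mem_iInter, mem_ofPred_eq, hSΩ _ γ.2, true_and,
        sub_le_iff_le_add]
    rw [this]
    exact (isClosed_iInter fun t => hsub t _ (continuous_const.add (hΦc.comp (hev t)))).preimage
      continuous_subtype_val
  obtain ⟨γ, hγ⟩ := exists_forall_lt_add_mul_dist hlsc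
    ⟨c, by rintro _ ⟨γ, rfl⟩; exact hcf γ⟩ hκ
  have hhigh : ∀ t, b < F (γ.1 t) - Φ (γ.1 t) →
      F (γ.1 t) ≤ F (γ₀ t) - Φ (γ₀ t) - δ / 2 * ‖γ.1 t - γ₀ t‖ + Φ (γ.1 t) := by
    intro t ht
    rcases γ.2.2.2 t with h | h
    · exact h.2
    · linarith [h.2]
  have hhigh₀ : ∀ t, b < F (γ.1 t) - Φ (γ.1 t) → b < F (γ₀ t) - Φ (γ₀ t) := fun t ht => by
    linarith [hhigh t ht, mul_nonneg hκ.le (norm_nonneg (γ.1 t - γ₀ t))]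
  have hdisj : Disjoint (closure {t | b < F (γ.1 t) - Φ (γ.1 t)}) B := by
    have : closure {t | b < F (γ.1 t) - Φ (γ.1 t)} ⊆ Nᶜ :=
      closure_minimal (fun t ht htN => absurd (hNb t htN) (not_le.2 (hhigh₀ t ht)))
        hN.isClosed_compl
    exact Set.disjoint_left.2 fun t ht htB => this ht (hBN htB)
  -- Points in the closure of the high set may themselves be low, but inherit the norm bound.
  have hnorm : closure {t | b < F (γ.1 t) - Φ (γ.1 t)} ⊆ {t | ‖γ.1 t‖ ≤ R + 1} := by
    refine closure_minimal (fun t ht => ?_)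
      (isClosed_le γ.1.continuous.norm continuous_const)
    have h1 := hhigh t ht
    have h2 : ‖γ.1 t - γ₀ t‖ ≤ 1 := by
      have h3 := hC t
      have h4 : b < F (γ.1 t) - Φ (γ.1 t) := ht
      by_contra! h5
      have := mul_lt_mul_of_pos_left h5 hκ
      linarith
    have h3 := hR t (hhigh₀ t ht)
    have h4 := norm_add_le (γ.1 t - γ₀ t) (γ₀ t)
    rw [sub_add_cancel] at h4
    simp only [mem_ofPred_eq]
    linarith
  obtain ⟨s, hs0, hs1, γ', h1, h2, h3, h4, h5, h6⟩ := exists_descent_step hF hcl hΦ hee hΩe hFe hΦe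
    hσ γ.2.1 (hSΩ _ γ.2) hB hBσ hδ hdisj (fun t ht => by
      rcases lt_or_ge (F (γ.1 t) - Φ (γ.1 t)) b with h | h
      · exact descentSet_nonempty_of_lt hδ (hSΩ _ γ.2 t) h
      · exact descentSet_nonempty_of_exists hδ
          (hPS _ (hSΩ _ γ.2 t) (hnorm ht) h (hSC _ γ.2 t)))
    (div_pos (sub_pos.2 hbc) hκ)
  have hs2 : δ / 2 * s ≤ c - b := by
    rw [le_div_iff₀ hκ] at hs1; linarith
  have hS' : γ' ∈ S := by
    refine ⟨h1, fun t ht => (h3 t ht).trans (γ.2.2.1 t ht), fun t => ?_⟩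
    rcases le_or_gt (F (γ.1 t) - Φ (γ.1 t)) b with h | h
    · exact Or.inr ⟨h2 t, by linarith [h5 t h]⟩
    · refine Or.inl ⟨h2 t, ?_⟩
      have k1 := h6 t h
      have k2 := hhigh t h
      have k3 : ‖γ' t - γ₀ t‖ ≤ s + ‖γ.1 t - γ₀ t‖ :=
        (norm_sub_le_norm_sub_add_norm_sub _ (γ.1 t) _).trans (by linarith [h4 t])
      have k4 := mul_le_mul_of_nonneg_left k3 hκ.le
      linarith
  -- Points below `b` do not affect the supremum, since `b ≤ f γ - δ / 2 * s`.
  have hdec : f ⟨γ', hS'⟩ ≤ f γ - δ / 2 * s := by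
    rw [hfle]
    intro t
    rcases le_or_gt (F (γ.1 t) - Φ (γ.1 t)) b with h | h
    · linarith [h5 t h, hcf γ]
    · linarith [h6 t h, (hfle γ _).1 le_rfl t]
  have hpos : 0 < δ / 2 * s := mul_pos hκ hs0
  have hdist : dist γ (⟨γ', hS'⟩ : S) ≤ s := by
    rw [Subtype.dist_eq, dist_comm]
    exact (ContinuousMap.dist_le hs0.le).2 fun t => by rw [dist_eq_norm]; exact h4 t
  have hlt := hγ ⟨γ', hS'⟩ (fun heq => by rw [heq] at hdec; linarith)
  linarith [mul_le_mul_of_nonneg_left hdist hκ.le]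

end Deformation

section Functional

variable {X : Type*} {Ψ : X → ℝ≥0∞} {Φ : X → ℝ}

/-! ### Passage to real-valued functionals -/

theorem I_of_ne_top {u : X} (hu : Ψ u ≠ ∞) (μ : ℝ) :
    I Ψ Φ μ u = ((μ * (Ψ u).toReal - Φ u : ℝ) : EReal) := by
  rw [I, ← EReal.coe_ennreal_toReal hu]
  norm_cast

theorem I_of_eq_top {u : X} (hu : Ψ u = ∞) {μ : ℝ} (hμ : 0 < μ) : I Ψ Φ μ u = ⊤ := by
  rw [I, hu, EReal.coe_ennreal_top, EReal.coe_mul_top_of_pos hμ, EReal.top_sub_coe]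

theorem I_le_coe_iff {u : X} {μ : ℝ} (hμ : 0 < μ) (a : ℝ) :
    I Ψ Φ μ u ≤ (a : EReal) ↔ Ψ u ≠ ∞ ∧ μ * (Ψ u).toReal - Φ u ≤ a := by
  by_cases hu : Ψ u = ∞
  · simp [I_of_eq_top hu hμ, hu]
  · simp only [I_of_ne_top hu, EReal.coe_le_coe_iff, ne_eq, hu, not_false_eq_true, true_and]

theorem I_mono {u : X} {μ ν : ℝ} (hμ : 0 < μ) (h : μ ≤ ν) : I Ψ Φ μ u ≤ I Ψ Φ ν u := by
  by_cases hu : Ψ u = ∞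
  · rw [I_of_eq_top hu hμ, I_of_eq_top hu (hμ.trans_le h)]
  · rw [I_of_ne_top hu, I_of_ne_top hu, EReal.coe_le_coe_iff]
    gcongr

variable [NormedAddCommGroup X]

theorem Psi2.exists_norm_le (hΨ : Psi2 Ψ) (M : ℝ) :
    ∃ R, ∀ u, Ψ u ≠ ∞ → (Ψ u).toReal ≤ M → ‖u‖ ≤ R := by
  have h := hΨ.eventually (lt_mem_nhds (ENNReal.ofReal_lt_top (r := M)))
  rw [eventually_comap, eventually_atTop] at h
  obtain ⟨R, hR⟩ := h
  refine ⟨R, fun u hu hM => ?_⟩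
  by_contra! hlt
  have h1 := hR ‖u‖ hlt.le u rfl
  rw [← ENNReal.ofReal_toReal hu] at h1
  exact absurd (ENNReal.ofReal_le_ofReal hM) (not_le.2 h1)

variable [NormedSpace ℝ X]

theorem Psi1.le_add (hΨ : Psi1 Ψ) (u v : X) {a b : ℝ} (ha : 0 ≤ a) (hb : 0 ≤ b) (hab : a + b = 1) :
    Ψ (a • u + b • v) ≤ ENNReal.ofReal a * Ψ u + ENNReal.ofReal b * Ψ v := by
  have hab' : a.toNNReal + b.toNNReal = 1 := by
    rw [← Real.toNNReal_add ha hb, hab, Real.toNNReal_one]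
  have h := hΨ.convex.2 (mem_univ u) (mem_univ v) zero_le zero_le hab'
  simp only [NNReal.smul_def, Real.coe_toNNReal _ ha, Real.coe_toNNReal _ hb,
    ENNReal.smul_def, smul_eq_mul] at h
  exact h

theorem Psi1.smul_le (hΨ : Psi1 Ψ) (u : X) {t : ℝ} (ht0 : 0 ≤ t) (ht1 : t ≤ 1) :
    Ψ (t • u) ≤ Ψ u := by
  have h := hΨ.le_add u 0 ht0 (sub_nonneg.2 ht1) (by ring)
  rw [smul_zero, add_zero, hΨ.zero, mul_zero, add_zero] at h
  exact h.trans (mul_le_of_le_one_left zero_le (by simpa using ht1))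

theorem Psi1.convexOn (hΨ : Psi1 Ψ) {μ : ℝ} (hμ : 0 ≤ μ) :
    ConvexOn ℝ {u | Ψ u ≠ ∞} fun u => μ * (Ψ u).toReal := by
  have key : ∀ u, Ψ u ≠ ∞ → ∀ v, Ψ v ≠ ∞ → ∀ a b : ℝ, 0 ≤ a → 0 ≤ b →
      ENNReal.ofReal a * Ψ u + ENNReal.ofReal b * Ψ v ≠ ∞ := fun u hu v hv a b _ _ =>
    ENNReal.add_ne_top.2 ⟨ENNReal.mul_ne_top ENNReal.ofReal_ne_top hu,
      ENNReal.mul_ne_top ENNReal.ofReal_ne_top hv⟩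
  refine ⟨fun u hu v hv a b ha hb hab => ?_, fun u hu v hv a b ha hb hab => ?_⟩
  · exact ((hΨ.le_add u v ha hb hab).trans_lt (key u hu v hv a b ha hb).lt_top).ne
  · have h := ENNReal.toReal_mono (key u hu v hv a b ha hb) (hΨ.le_add u v ha hb hab)
    rw [ENNReal.toReal_add (ENNReal.mul_ne_top ENNReal.ofReal_ne_top hu)
      (ENNReal.mul_ne_top ENNReal.ofReal_ne_top hv), ENNReal.toReal_mul, ENNReal.toReal_mul,
      ENNReal.toReal_ofReal ha, ENNReal.toReal_ofReal hb] at h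
    simp only [smul_eq_mul]
    nlinarith [mul_le_mul_of_nonneg_left h hμ]

theorem Psi1.isClosed_epigraph (hΨ : Psi1 Ψ) {μ : ℝ} (hμ : 0 < μ) :
    IsClosed {p : X × ℝ | p.1 ∈ {u | Ψ u ≠ ∞} ∧ μ * (Ψ p.1).toReal ≤ p.2} := by
  have heq : {p : X × ℝ | p.1 ∈ {u | Ψ u ≠ ∞} ∧ μ * (Ψ p.1).toReal ≤ p.2} =
      {p : X × ℝ | 0 ≤ p.2} ∩
        (fun p : X × ℝ => (p.1, ENNReal.ofReal (p.2 / μ))) ⁻¹' {q | Ψ q.1 ≤ q.2} := by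
    ext p
    simp only [mem_ofPred_eq, mem_inter_iff, mem_preimage]
    constructor
    · rintro ⟨h1, h2⟩
      refine ⟨(mul_nonneg hμ.le ENNReal.toReal_nonneg).trans h2, ?_⟩
      rw [← ENNReal.ofReal_toReal h1]
      exact ENNReal.ofReal_le_ofReal (by rw [le_div_iff₀ hμ]; linarith)
    · rintro ⟨h1, h2⟩
      refine ⟨(h2.trans_lt ENNReal.ofReal_lt_top).ne, ?_⟩
      have := ENNReal.toReal_mono ENNReal.ofReal_ne_top h2
      rw [ENNReal.toReal_ofReal (div_nonneg h1 hμ.le), le_div_iff₀ hμ] at this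
      linarith
  rw [heq]
  exact (isClosed_le continuous_const continuous_snd).inter
    (hΨ.lsc.isClosed_epigraph.preimage (continuous_fst.prodMk
      (ENNReal.continuous_ofReal.comp (continuous_snd.div_const μ))))

/-- Approximate critical points with all positive tolerances yield a bounded Palais–Smale
sequence. -/
theorem exists_isPalaisSmale_of_forall {lam c R : ℝ} (hlam : 0 < lam)
    (h : ∀ δ > 0, ∃ u, Ψ u ≠ ∞ ∧ ‖u‖ ≤ R ∧ |lam * (Ψ u).toReal - Φ u - c| ≤ δ ∧
      ∀ v, Ψ v ≠ ∞ → -(δ * ‖v - u‖) ≤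
        lam * (Ψ v).toReal - lam * (Ψ u).toReal - fderiv ℝ Φ u (v - u)) :
    ∃ u : ℕ → X, IsPalaisSmale Ψ Φ lam c u ∧ Bornology.IsBounded (range u) := by
  choose u hu hR hc hv using fun n : ℕ => h (1 / ((n : ℝ) + 1)) Nat.one_div_pos_of_nat
  have hlim : Tendsto (fun n : ℕ => 1 / ((n : ℝ) + 1)) atTop (𝓝 0) :=
    tendsto_one_div_add_atTop_nhds_zero_nat
  refine ⟨u, ⟨?_, fun n => 1 / ((n : ℝ) + 1), fun n => Nat.one_div_pos_of_nat, hlim, ?_⟩, ?_⟩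
  · simp only [I_of_ne_top (hu _)]
    refine (continuous_coe_real_ereal.tendsto c).comp ?_
    rw [tendsto_iff_dist_tendsto_zero]
    exact squeeze_zero (fun _ => dist_nonneg) hc hlim
  · intro n v
    by_cases hvt : Ψ v = ∞
    · rw [hvt, EReal.coe_ennreal_top, ← EReal.coe_ennreal_toReal (hu n), EReal.top_sub_coe,
        EReal.coe_mul_top_of_pos hlam, EReal.top_sub_coe]
      exact le_top
    · rw [← EReal.coe_ennreal_toReal hvt, ← EReal.coe_ennreal_toReal (hu n),
        ← EReal.coe_sub, ← EReal.coe_mul, ← EReal.coe_sub, EReal.coe_le_coe_iff]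
      have := hv n v hvt
      rw [← mul_sub] at this
      exact this
  · exact isBounded_iff_forall_norm_le.2 ⟨R, by rintro _ ⟨n, rfl⟩; exact hR n⟩

/-! ### The minimax principle -/

/-- Maps `γ` continuous on `s`, equivariant for `σ` and `e`, with values prescribed by `p` on the
boundary `B`. -/
def equivariantMaps {Y : Type*} [TopologicalSpace Y] (s : Set Y) (σ : Y → Y) (e : X ≃ₗᵢ[ℝ] X)
    (B : Set Y) (p : Y → X) : Set (Y → X) :=
  {γ | ContinuousOn γ s ∧ (∀ y ∈ s, γ (σ y) = e (γ y)) ∧ ∀ y ∈ B, γ y = p y}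

/-- The minimax value of `I_μ` over the family `G` of maps on `s`. -/
noncomputable def minimax {Y : Type*} (Ψ : X → ℝ≥0∞) (Φ : X → ℝ) (s : Set Y)
    (G : Set (Y → X)) (μ : ℝ) : EReal :=
  ⨅ γ ∈ G, ⨆ y ∈ s, I Ψ Φ μ (γ y)

/-- The monotonicity trick: at a point of differentiability of the minimax value, nearly optimal
maps for `I_{lam + h}` have their high points for `I_lam` in a ball independent of `h`. The map `r`
reparametrises the domain so that a neighbourhood of the boundary is sent to the boundary, where
the functional is low. -/
theorem exists_bounded_palaisSmale [CompleteSpace X] {Y : Type*} [MetricSpace Y] {s : Set Y}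
    (hs : IsCompact s) (hsne : s.Nonempty) {σ : Y → Y} (hσc : ContinuousOn σ s)
    (hσs : MapsTo σ s s) (hσσ : ∀ y ∈ s, σ (σ y) = y) {B : Set Y} (hB : IsClosed B) (hBs : B ⊆ s)
    (hBσ : MapsTo σ B B) {r : Y → Y} (hrc : ContinuousOn r s) (hrs : MapsTo r s s)
    (hrσ : ∀ y ∈ s, r (σ y) = σ (r y)) (hrB : ∀ y ∈ B, r y = y) {N : Set Y} (hN : IsOpen N)
    (hBN : B ⊆ N) (hrN : ∀ y ∈ N, y ∈ s → r y ∈ B)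
    (hΨ1 : Psi1 Ψ) (hΨ2 : Psi2 Ψ) (hΦ1 : Phi1 Φ) {e : X ≃ₗᵢ[ℝ] X} (hee : ∀ x, e (e x) = x)
    (hΨe : ∀ x, Ψ (e x) = Ψ x) (hΦe : ∀ x, Φ (e x) = Φ x) {p : Y → X} {lam : ℝ}
    (hlam : 0 < lam) (hp : ∀ y ∈ B, I Ψ Φ lam (p y) ≤ 0) {α : ℝ} (hα : 0 < α)
    (hlow : ∀ μ, lam ≤ μ → (α : EReal) ≤ minimax Ψ Φ s (equivariantMaps s σ e B p) μ)
    (htop : ∀ μ, lam ≤ μ → minimax Ψ Φ s (equivariantMaps s σ e B p) μ < ⊤)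
    (hd : DifferentiableAt ℝ
      (fun μ : ℝ => (minimax Ψ Φ s (equivariantMaps s σ e B p) μ).toReal) lam) :
    ∃ c : ℝ, (c : EReal) = minimax Ψ Φ s (equivariantMaps s σ e B p) lam ∧
      ∃ u : ℕ → X, IsPalaisSmale Ψ Φ lam c u ∧ Bornology.IsBounded (range u) := by
  set G := equivariantMaps s σ e B p
  set V : ℝ → ℝ := fun μ => (minimax Ψ Φ s G μ).toReal
  have hVcoe : ∀ μ, lam ≤ μ → ((V μ : ℝ) : EReal) = minimax Ψ Φ s G μ := fun μ hμ =>
    EReal.coe_toReal (htop μ hμ).ne ((EReal.bot_lt_coe α).trans_le (hlow μ hμ)).ne'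
  have hαV : α ≤ V lam := by
    rw [← EReal.coe_le_coe_iff, hVcoe lam le_rfl]; exact hlow lam le_rfl
  refine ⟨V lam, hVcoe lam le_rfl, ?_⟩
  set d := deriv V lam
  -- `|d| + 3` bounds `Ψ` at the high points: `|d| + 1` comes from the difference quotient of `V`,
  -- one unit from the error `h` of the nearly optimal map and one from the threshold `V lam - h`.
  obtain ⟨R, hR⟩ := hΨ2.exists_norm_le (|d| + 3)
  refine exists_isPalaisSmale_of_forall (R := R + 1) hlam fun δ hδ => ?_
  by_contra! hcon
  obtain ⟨h, hh0, hhα, hhδ, hVh⟩ : ∃ h > 0, h < α ∧ (|d| + 3) * h ≤ δ / 2 ∧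
      |V (lam + h) - V lam| ≤ (|d| + 1) * h := by
    have h1 := (hasDerivAt_iff_isLittleO_nhds_zero.1 hd.hasDerivAt).bound one_pos
    have hd3 : 0 < |d| + 3 := by positivity
    have h2 : ∀ᶠ h in 𝓝[>] (0 : ℝ), h < α ∧ h < δ / 2 / (|d| + 3) :=
      nhdsWithin_le_nhds ((gt_mem_nhds hα).and
        (gt_mem_nhds (div_pos (half_pos hδ) hd3)))
    have h1' := h1.filter_mono (nhdsWithin_le_nhds (s := Ioi 0))
    obtain ⟨h, ⟨k1, k2, k3⟩, k4⟩ := ((h1'.and h2).and self_mem_nhdsWithin).exists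
    have k4 : 0 < h := k4
    refine ⟨h, k4, k2, ?_, ?_⟩
    · rw [lt_div_iff₀ hd3] at k3; linarith
    · rw [smul_eq_mul, Real.norm_eq_abs, Real.norm_eq_abs, abs_of_pos k4, one_mul] at k1
      have k5 := abs_sub_abs_le_abs_sub (V (lam + h) - V lam) (h * d)
      rw [abs_mul, abs_of_pos k4] at k5
      have k6 := k5.trans k1
      linarith
  have hlamh : 0 < lam + h := by linarith
  -- A nearly optimal map for the larger parameter `lam + h`.
  obtain ⟨γ, hγG, hγ⟩ : ∃ γ ∈ G, ⨆ y ∈ s, I Ψ Φ (lam + h) (γ y) <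
      ((V (lam + h) + h : ℝ) : EReal) := by
    have : minimax Ψ Φ s G (lam + h) < ((V (lam + h) + h : ℝ) : EReal) := by
      rw [← hVcoe _ (by linarith), EReal.coe_lt_coe_iff]; linarith
    simpa only [minimax, iInf_lt_iff, exists_prop] using this
  have hγle : ∀ y ∈ s, Ψ (γ y) ≠ ∞ ∧
      (lam + h) * (Ψ (γ y)).toReal - Φ (γ y) ≤ V (lam + h) + h := fun y hy =>
    (I_le_coe_iff hlamh _).1 ((le_iSup₂ (f := fun y _ => I Ψ Φ (lam + h) (γ y)) y hy).trans hγ.le)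
  have hVabs := abs_le.1 hVh
  have hdh : 0 ≤ |d| * h := mul_nonneg (abs_nonneg d) hh0.le
  -- The reparametrised map takes boundary values on a neighbourhood of the boundary.
  let γ₀ : C(s, X) := ⟨fun y => γ (r y),
    (hγG.1.comp hrc hrs).comp_continuous continuous_subtype_val fun y => y.2⟩
  let σ' : C(s, s) := ⟨hσs.restrict, hσc.mapsToRestrict hσs⟩
  have : CompactSpace s := isCompact_iff_compactSpace.1 hs
  have : Nonempty s := hsne.to_subtype
  have hγ₀ : ∀ y : s, γ₀ y = γ (r y) := fun _ => rfl
  have hΨγ : ∀ y : s, 0 ≤ h * (Ψ (γ₀ y)).toReal := fun y =>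
    mul_nonneg hh0.le ENNReal.toReal_nonneg
  obtain ⟨γ', h1, h2, h3, a, hac, ha⟩ := exists_family_lt (Ω := {u | Ψ u ≠ ∞})
    (F := fun u => lam * (Ψ u).toReal) (Φ := Φ) (δ := δ) (b := V lam - h) (e := e) (σ := σ')
    (γ₀ := γ₀) (B := Subtype.val ⁻¹' B) (N := Subtype.val ⁻¹' N) (C := V (lam + h) + h) (R := R)
    (c := V lam) (hΨ1.convexOn hlam.le) (hΨ1.isClosed_epigraph hlam) hΦ1 hee
    (fun x hx => by rwa [mem_ofPred_eq, hΨe]) (fun x => by rw [hΨe]) hΦe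
    (fun y => Subtype.ext (hσσ y y.2))
    (fun y => by
      change γ (r (σ y)) = e (γ (r y))
      rw [hrσ y y.2, hγG.2.1 _ (hrs y.2)])
    (fun y => (hγle _ (hrs y.2)).1) (hB.preimage continuous_subtype_val) (fun y hy => hBσ hy)
    (hN.preimage continuous_subtype_val) (preimage_mono hBN) hδ
    (fun y hy => by
      have hyB := hrN y hy y.2
      have hle := ((I_le_coe_iff (Ψ := Ψ) (Φ := Φ) hlam 0).1 (by simpa using hp _ hyB)).2
      rw [hγ₀, hγG.2.2 _ hyB]
      linarith)
    (fun y => by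
      have k1 := (hγle _ (hrs y.2)).2
      have k2 := hΨγ y
      rw [hγ₀] at k2 ⊢
      linarith)
    (fun y hy => by
      refine hR _ (hγle _ (hrs y.2)).1 ?_
      have k1 := (hγle _ (hrs y.2)).2
      rw [hγ₀] at hy
      have k2 : h * (Ψ (γ (r y))).toReal ≤ h * (|d| + 3) := by linarith
      exact le_of_mul_le_mul_left k2 hh0)
    (by linarith) (by linarith)
    (fun w hw hwR hwb hwC => by
      obtain ⟨v, hv, hlt⟩ := hcon w hw hwR (abs_le.2 ⟨by linarith, by linarith⟩)
      exact ⟨v, hv, hlt⟩)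
  classical
  let g : Y → X := fun y => if hy : y ∈ s then γ' ⟨y, hy⟩ else 0
  have hg : ∀ y (hy : y ∈ s), g y = γ' ⟨y, hy⟩ := fun y hy => dif_pos hy
  have hgG : g ∈ G := by
    refine ⟨?_, fun y hy => ?_, fun y hy => ?_⟩
    · rw [continuousOn_iff_continuous_domRestrict]
      convert γ'.continuous using 1
      ext y; exact hg y y.2
    · rw [hg _ (hσs hy), hg y hy]; exact h1 ⟨y, hy⟩
    · rw [hg y (hBs hy), h2 ⟨y, hBs hy⟩ hy, hγ₀]
      simp only [hrB y hy]
      exact hγG.2.2 y hy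
  have hle : minimax Ψ Φ s G lam ≤ (a : EReal) :=
    (iInf₂_le g hgG).trans (iSup₂_le fun y hy => by
      rw [hg y hy]; exact (I_le_coe_iff hlam a).2 ⟨h3 _, ha _⟩)
  rw [← hVcoe lam le_rfl, EReal.coe_le_coe_iff] at hle
  linarith

end Functional

section Minimax

variable {X : Type*} [NormedAddCommGroup X] {Ψ : X → ℝ≥0∞} {Φ : X → ℝ}

/-! ### Bounds for the minimax values -/

/-- Maps which link the origin to the outside of the sphere of radius `ρ₀` have to cross it. -/
theorem le_minimax {Y : Type*} [TopologicalSpace Y] {s : Set Y} (hs : IsPreconnected s)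
    {G : Set (Y → X)} {ρ₀ α₀ μ₀ μ : ℝ} (hρ : 0 < ρ₀) (hμ₀ : 0 < μ₀) (hμ : μ₀ ≤ μ)
    (hinf : ⨅ u ∈ sphere (0 : X) ρ₀, I Ψ Φ μ₀ u = (α₀ : EReal))
    (hG : ∀ γ ∈ G, ContinuousOn γ s ∧ (∃ y ∈ s, γ y = 0) ∧ ∃ y ∈ s, ρ₀ < ‖γ y‖) :
    (α₀ : EReal) ≤ minimax Ψ Φ s G μ := by
  refine le_iInf₂ fun γ hγ => ?_
  obtain ⟨hc, ⟨y₀, hy₀, h0⟩, y₁, hy₁, h1⟩ := hG γ hγ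
  obtain ⟨y, hy, hyρ⟩ := hs.intermediate_value hy₀ hy₁ hc.norm
    (show ρ₀ ∈ Icc ‖γ y₀‖ ‖γ y₁‖ from ⟨by rw [h0, norm_zero]; exact hρ.le, h1.le⟩)
  calc (α₀ : EReal) ≤ I Ψ Φ μ₀ (γ y) := by
        rw [← hinf]
        exact iInf₂_le (f := fun u (_ : u ∈ sphere (0 : X) ρ₀) => I Ψ Φ μ₀ u) (γ y)
          (by simpa using hyρ)
    _ ≤ I Ψ Φ μ (γ y) := I_mono hμ₀ hμ
    _ ≤ _ := le_iSup₂ (f := fun y _ => I Ψ Φ μ (γ y)) y hy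

theorem minimax_lt_top {Y : Type*} [TopologicalSpace Y] {s : Set Y} (hs : IsCompact s)
    (hΦ : Continuous Φ) {G : Set (Y → X)} {γ : Y → X} (hγ : γ ∈ G) (hc : ContinuousOn γ s) {K : ℝ}
    (hK : ∀ y ∈ s, Ψ (γ y) ≤ ENNReal.ofReal K) {μ : ℝ} (hμ : 0 < μ) :
    minimax Ψ Φ s G μ < ⊤ := by
  obtain ⟨A, hA⟩ := hs.exists_bound_of_continuousOn (hΦ.comp_continuousOn hc)
  refine lt_of_le_of_lt ((iInf₂_le γ hγ).trans (iSup₂_le fun y hy => ?_))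
    (EReal.coe_lt_top (μ * max K 0 + A))
  have h1 := hK y hy
  refine (I_le_coe_iff hμ _).2 ⟨(h1.trans_lt ENNReal.ofReal_lt_top).ne, ?_⟩
  have h2 := ENNReal.toReal_mono ENNReal.ofReal_ne_top h1
  rw [ENNReal.toReal_ofReal'] at h2
  have h3 := mul_le_mul_of_nonneg_left h2 hμ.le
  have h4 := (abs_le.1 (hA y hy)).1
  simp only [Function.comp] at h4
  linarith

variable [NormedSpace ℝ X]

/-! ### The mountain pass value -/

/-- Paths are the case of the trivial symmetry; the boundary values are those of the segment from
`0` to `u₀`. -/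
theorem Gamma0_eq (u₀ : X) : Gamma0 u₀ =
    equivariantMaps (Icc 0 1) id (LinearIsometryEquiv.refl ℝ X) {0, 1} fun t => t • u₀ := by
  ext γ
  simp [Gamma0, equivariantMaps]

theorem exists_bounded_palaisSmale_c0 [CompleteSpace X] (hΨ1 : Psi1 Ψ) (hΨ2 : Psi2 Ψ)
    (hΦ1 : Phi1 Φ) {ρ₀ α₀ ε : ℝ} {u₀ : X} (h : MP Ψ Φ ρ₀ α₀ ε u₀) {lam : ℝ}
    (hlam : lam ∈ Ioo (1 - ε) (1 + ε))
    (hd : DifferentiableAt ℝ (fun μ : ℝ => (c0 Ψ Φ u₀ μ).toReal) lam) :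
    ∃ c : ℝ, (c : EReal) = c0 Ψ Φ u₀ lam ∧
      ∃ u : ℕ → X, IsPalaisSmale Ψ Φ lam c u ∧ Bornology.IsBounded (range u) := by
  have hε := h.eps_lt_one
  have hlam0 : 0 < lam := by linarith [hlam.1]
  have hc0 : ∀ μ, c0 Ψ Φ u₀ μ = minimax Ψ Φ (Icc (0 : ℝ) 1) (equivariantMaps (Icc 0 1) id
      (LinearIsometryEquiv.refl ℝ X) {0, 1} fun t => t • u₀) μ := fun μ => by
    rw [← Gamma0_eq]; rfl
  simp only [hc0] at hd ⊢
  have hend : I Ψ Φ (1 + ε) 0 ≤ 0 ∧ I Ψ Φ (1 + ε) u₀ ≤ 0 := max_le_iff.1 h.end_le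
  have hu₀ : Ψ u₀ ≠ ∞ :=
    ((I_le_coe_iff (Φ := Φ) (by linarith [h.eps_pos] : 0 < 1 + ε) 0).1
      (by simpa using hend.2)).1
  -- The reparametrisation rests at `0` on `[0, 1 / 4]` and at `1` on `[3 / 4, 1]`.
  refine exists_bounded_palaisSmale (N := Iio (1 / 4) ∪ Ioi (3 / 4))
    (r := fun t => max 0 (min 1 (2 * t - 1 / 2))) isCompact_Icc ⟨0, by simp⟩ continuousOn_id
    (mapsTo_id _) (fun _ _ => rfl) (toFinite _).isClosed ?_ (mapsTo_id _)
    (Continuous.continuousOn (by fun_prop)) ?_ (fun _ _ => rfl) ?_ (isOpen_Iio.union isOpen_Ioi) ?_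
    ?_ hΨ1 hΨ2 hΦ1 (fun _ => rfl) (fun _ => rfl) (fun _ => rfl) hlam0 ?_ h.alpha_pos ?_ ?_ hd
  · rintro t (rfl | rfl) <;> simp
  · exact fun t _ => ⟨le_max_left _ _, max_le zero_le_one (min_le_left _ _)⟩
  · rintro t (rfl | rfl) <;> norm_num
  · rintro t (rfl | rfl) <;> norm_num
  · rintro t (ht | ht) -
    · left
      rw [mem_Iio] at ht
      exact max_eq_left ((min_le_right _ _).trans (by linarith))
    · right
      rw [mem_Ioi] at ht
      rw [mem_singleton_iff, min_eq_left (by linarith), max_eq_right zero_le_one]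
  · rintro t (rfl | rfl)
    · simpa using (I_mono hlam0 hlam.2.le).trans hend.1
    · simpa using (I_mono hlam0 hlam.2.le).trans hend.2
  · intro μ hμ
    refine le_minimax isPreconnected_Icc h.rho_pos (by linarith) (hlam.1.le.trans hμ) h.inf_eq
      fun γ hγ => ?_
    rw [← Gamma0_eq] at hγ
    exact ⟨hγ.1, ⟨0, by simp, hγ.2.1⟩, 1, by simp, by rw [hγ.2.2]; exact h.norm_gt⟩
  -- The segment from `0` to `u₀` is an admissible path of finite height.
  · intro μ hμ
    have hcont : Continuous fun t : ℝ => t • u₀ := by fun_prop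
    refine minimax_lt_top isCompact_Icc hΦ1.continuous (γ := fun t => t • u₀)
      (K := (Ψ u₀).toReal) ?_ hcont.continuousOn (fun t ht => ?_) (hlam0.trans_le hμ)
    · exact ⟨hcont.continuousOn, by simp, by simp⟩
    rw [ENNReal.ofReal_toReal hu₀]
    exact hΨ1.smul_le u₀ ht.1 ht.2

/-! ### The symmetric minimax values -/

/-- The cone `ζ ↦ ‖ζ‖ p (ζ / ‖ζ‖)` over an odd map `p` on the unit sphere is an admissible map. Its
values lie on segments from the origin to values of `p`, so that convexity bounds `Ψ` on it. -/
theorem exists_odd_extension {k : ℕ} {p : EuclideanSpace ℝ (Fin k) → X}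
    (hp : ContinuousOn p (bdisk k)) (hodd : ∀ ζ ∈ bdisk k, p (-ζ) = -p ζ) :
    ∃ γ ∈ Gamma k p, ∀ ζ ∈ disk k, γ ζ = 0 ∨
      ∃ t : ℝ, 0 ≤ t ∧ t ≤ 1 ∧ ∃ η ∈ bdisk k, γ ζ = t • p η := by
  have hunit : ∀ ζ : EuclideanSpace ℝ (Fin k), ζ ≠ 0 → ‖ζ‖⁻¹ • ζ ∈ bdisk k := fun ζ hζ => by
    rw [mem_sphere_zero_iff_norm, norm_smul, norm_inv, norm_norm,
      inv_mul_cancel₀ (norm_ne_zero_iff.2 hζ)]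
  refine ⟨fun ζ => ‖ζ‖ • p (‖ζ‖⁻¹ • ζ), ⟨?_, fun ζ _ => ?_, fun ζ hζ => ?_⟩, fun ζ hζ => ?_⟩
  · refine Continuous.continuousOn (continuous_iff_continuousAt.2 fun ζ => ?_)
    by_cases hζ : ζ = 0
    · subst hζ
      have hcpt : IsCompact (bdisk k) := isCompact_sphere _ _
      obtain ⟨K, hK⟩ := hcpt.exists_bound_of_continuousOn hp
      have hlim : Tendsto (fun ζ : EuclideanSpace ℝ (Fin k) => ‖ζ‖ * K) (𝓝 0) (𝓝 0) := by
        have : Continuous fun ζ : EuclideanSpace ℝ (Fin k) => ‖ζ‖ * K := by fun_prop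
        simpa using this.tendsto 0
      have := squeeze_zero_norm (f := fun ζ => ‖ζ‖ • p (‖ζ‖⁻¹ • ζ)) (fun ζ => ?_) hlim
      · simpa [ContinuousAt] using this
      · by_cases hζ : ζ = 0
        · simp [hζ]
        · rw [norm_smul, norm_norm]
          exact mul_le_mul_of_nonneg_left (hK _ (hunit ζ hζ)) (norm_nonneg ζ)
    · have hc : ContinuousOn (fun ζ : EuclideanSpace ℝ (Fin k) => ‖ζ‖⁻¹ • ζ) {0}ᶜ :=
        (continuous_norm.continuousOn.inv₀ fun ζ hζ => norm_ne_zero_iff.2 hζ).smul continuousOn_id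
      exact (continuous_norm.continuousOn.smul (hp.comp hc hunit)).continuousAt
        (isOpen_compl_singleton.mem_nhds hζ)
  · by_cases hζ : ζ = 0
    · simp [hζ]
    · simp only [norm_neg, smul_neg, hodd _ (hunit ζ hζ)]
  · have : ‖ζ‖ = 1 := by simpa using hζ
    simp [this]
  · by_cases h0 : ζ = 0
    · left; simp [h0]
    · exact Or.inr ⟨‖ζ‖, norm_nonneg ζ, by simpa using hζ, _, hunit ζ h0, rfl⟩

theorem exists_bounded_palaisSmale_c [CompleteSpace X] (hΨ1 : Psi1 Ψ) (hΨ2 : Psi2 Ψ)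
    (hΦ1 : Phi1 Φ) (hE : EvenPair Ψ Φ) {ρ₀ α₀ ε : ℝ} {π : (k : ℕ) → EuclideanSpace ℝ (Fin k) → X}
    (h : SMP Ψ Φ ρ₀ α₀ ε π) {k : ℕ} (hk : 1 ≤ k) {lam : ℝ} (hlam : lam ∈ Ioo (1 - ε) (1 + ε))
    (hd : DifferentiableAt ℝ (fun μ : ℝ => (NonsmoothMinimax.c Ψ Φ k (π k) μ).toReal) lam) :
    ∃ c : ℝ, (c : EReal) = NonsmoothMinimax.c Ψ Φ k (π k) lam ∧
      ∃ u : ℕ → X, IsPalaisSmale Ψ Φ lam c u ∧ Bornology.IsBounded (range u) := by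
  have hε := h.eps_lt_one
  have hε0 := h.eps_pos
  have hlam0 : 0 < lam := by linarith [hlam.1]
  have hckM : ∀ μ, NonsmoothMinimax.c Ψ Φ k (π k) μ = minimax Ψ Φ (disk k)
      (equivariantMaps (disk k) Neg.neg (LinearIsometryEquiv.neg ℝ) (bdisk k) (π k)) μ :=
    fun _ => rfl
  simp only [hckM] at hd ⊢
  have hsub : bdisk k ⊆ disk k := sphere_subset_closedBall
  obtain ⟨η, hη⟩ : (bdisk k).Nonempty := by
    have : Nonempty (Fin k) := ⟨⟨0, hk⟩⟩
    exact NormedSpace.sphere_nonempty.2 zero_le_one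
  have hbd : ∀ ζ ∈ bdisk k, I Ψ Φ (1 + ε) (π k ζ) ≤ 0 := fun ζ hζ =>
    (le_iSup₂ (f := fun ζ (_ : ζ ∈ bdisk k) => I Ψ Φ (1 + ε) (π k ζ)) ζ hζ).trans
      (h.sup_lt k hk).le
  have hdisk : IsCompact (disk k) := isCompact_closedBall _ _
  have hmax : ∀ ζ : EuclideanSpace ℝ (Fin k), 0 < max ‖ζ‖ (1 / 2) := fun ζ =>
    lt_max_of_lt_right (by norm_num)
  -- The radial map which expands the disk of radius `1 / 2` onto the unit disk.
  refine exists_bounded_palaisSmale (N := {ζ | 1 / 2 < ‖ζ‖})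
    (r := fun ζ => (max ‖ζ‖ (1 / 2))⁻¹ • ζ) hdisk ⟨η, hsub hη⟩ continuous_neg.continuousOn
    (fun ζ hζ => by simpa using hζ) (fun ζ _ => neg_neg ζ) isClosed_sphere hsub
    (fun ζ hζ => by simpa using hζ) ?_ ?_ (fun ζ _ => by simp) ?_
    (isOpen_lt continuous_const continuous_norm) ?_ ?_ hΨ1 hΨ2 hΦ1 (fun x => neg_neg x)
    (fun x => (hE x).1) (fun x => (hE x).2) hlam0
    (fun ζ hζ => (I_mono hlam0 hlam.2.le).trans (hbd ζ hζ)) h.alpha_pos ?_ ?_ hd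
  · have : Continuous fun ζ : EuclideanSpace ℝ (Fin k) => max ‖ζ‖ (1 / 2) := by fun_prop
    exact ((this.inv₀ fun ζ => (hmax ζ).ne').smul continuous_id).continuousOn
  · intro ζ _
    rw [mem_closedBall_zero_iff, norm_smul, norm_inv, Real.norm_of_nonneg (hmax ζ).le,
      inv_mul_le_one₀ (hmax ζ)]
    exact le_max_left _ _
  · intro ζ hζ
    have : ‖ζ‖ = 1 := by simpa using hζ
    simp only [this]
    norm_num
  · intro ζ hζ
    have : ‖ζ‖ = 1 := by simpa using hζ
    simp only [mem_ofPred_eq, this]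
    norm_num
  · intro ζ hζ _
    have hζ' : 1 / 2 < ‖ζ‖ := hζ
    simp only [max_eq_left hζ'.le]
    rw [mem_sphere_zero_iff_norm, norm_smul, norm_inv, norm_norm,
      inv_mul_cancel₀ (by linarith)]
  · intro μ hμ
    refine le_minimax (convex_closedBall _ _).isPreconnected h.rho_pos (by linarith)
      (hlam.1.le.trans hμ) h.inf_eq fun γ hγ => ⟨hγ.1, ⟨0, by simp, ?_⟩, η, hsub hη, ?_⟩
    · have h0 : γ (-0) = -γ 0 := hγ.2.1 0 (by simp)
      rw [neg_zero] at h0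
      have h2 : (2 : ℝ) • γ 0 = 0 := by rw [two_smul, ← eq_neg_iff_add_eq_zero]; exact h0
      exact (smul_eq_zero.1 h2).resolve_left two_ne_zero
    · rw [hγ.2.2 η hη]; exact h.norm_gt k hk η hη
  · intro μ hμ
    obtain ⟨γ, hγ, hγζ⟩ := exists_odd_extension (h.cont k hk) (h.odd k hk)
    have hcpt : IsCompact (bdisk k) := isCompact_sphere _ _
    obtain ⟨A, hA⟩ := hcpt.exists_bound_of_continuousOn
      (hΦ1.continuous.comp_continuousOn (h.cont k hk))
    refine minimax_lt_top hdisk hΦ1.continuous (γ := γ) hγ hγ.1 (K := A) (fun ζ hζ => ?_)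
      (hlam0.trans_le hμ)
    rcases hγζ ζ hζ with h0 | ⟨t, ht0, ht1, ξ, hξ, heq⟩
    · rw [h0, hΨ1.zero]; exact zero_le
    · rw [heq]
      refine (hΨ1.smul_le _ ht0 ht1).trans ?_
      obtain ⟨h1, h2⟩ := (I_le_coe_iff (Ψ := Ψ) (Φ := Φ) (by linarith : 0 < 1 + ε) 0).1
        (by simpa using hbd ξ hξ)
      rw [← ENNReal.ofReal_toReal h1]
      refine ENNReal.ofReal_le_ofReal ?_
      have h3 := (abs_le.1 (hA ξ hξ)).2
      simp only [Function.comp] at h3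
      nlinarith [mul_nonneg hε0.le (ENNReal.toReal_nonneg (a := Ψ (π k ξ)))]

end Minimax

end NonsmoothMinimax

theorem mainTheorem4 {X : Type*} [NormedAddCommGroup X] [NormedSpace ℝ X] [CompleteSpace X]
    (Ψ : X → ℝ≥0∞) (Φ : X → ℝ)
    (hΨ1 : NonsmoothMinimax.Psi1 Ψ) (hΨ2 : NonsmoothMinimax.Psi2 Ψ)
    (hΦ1 : NonsmoothMinimax.Phi1 Φ) :
    (∀ (ρ₀ α₀ ε : ℝ) (u₀ : X), NonsmoothMinimax.MP Ψ Φ ρ₀ α₀ ε u₀ →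
      ∀ lam ∈ Ioo (1 - ε) (1 + ε),
        DifferentiableAt ℝ (fun μ : ℝ => (NonsmoothMinimax.c0 Ψ Φ u₀ μ).toReal) lam →
        ∃ c : ℝ, (c : EReal) = NonsmoothMinimax.c0 Ψ Φ u₀ lam ∧
          ∃ u : ℕ → X, NonsmoothMinimax.IsPalaisSmale Ψ Φ lam c u ∧
            Bornology.IsBounded (Set.range u)) ∧
    (NonsmoothMinimax.EvenPair Ψ Φ →
      ∀ (ρ₀ α₀ ε : ℝ) (π : (k : ℕ) → EuclideanSpace ℝ (Fin k) → X),
        NonsmoothMinimax.SMP Ψ Φ ρ₀ α₀ ε π →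
      ∀ k : ℕ, 1 ≤ k → ∀ lam ∈ Ioo (1 - ε) (1 + ε),
        DifferentiableAt ℝ (fun μ : ℝ => (NonsmoothMinimax.c Ψ Φ k (π k) μ).toReal) lam →
        ∃ c : ℝ, (c : EReal) = NonsmoothMinimax.c Ψ Φ k (π k) lam ∧
          ∃ u : ℕ → X, NonsmoothMinimax.IsPalaisSmale Ψ Φ lam c u ∧
            Bornology.IsBounded (Set.range u)) := by
  exact ⟨fun _ _ _ _ h _ hlam hd =>
      NonsmoothMinimax.exists_bounded_palaisSmale_c0 hΨ1 hΨ2 hΦ1 h hlam hd,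
    fun hE _ _ _ _ h _ hk _ hlam hd =>
      NonsmoothMinimax.exists_bounded_palaisSmale_c hΨ1 hΨ2 hΦ1 hE h hk hlam hd⟩
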